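/- Let $R$ be a commutative ring with unit, let $u=(u_i)_i$ be a finite or infinite (indexed by $\mathbb N$) regular sequence in $R$, i.e. each $u_i$ is a non-zero-divisor on $R/(u_j : j<i)$, let $I=(u_i : i)$, and let $s\ge 1$. Let $\mathbf K_*=\Lambda_R(e_i : i)$ be the exterior algebra on generators $e_i$ of degree $1$. Every $y\in\mathbf K_{n+1}$ has contractions $y_j\in\mathbf K_n$, linear in $y$ and almost all zero, determined by $$(e_{i_0}\wedge\cdots\wedge e_{i_n})_j=\sum_{r\,:\,i_r=j}(-1)^r\, e_{i_0}\wedge\cdots\widehat{e_{i_r}}\cdots\wedge e_{i_n},$$ and the Koszul differential is $\mathrm d y=\sum_j u_j y_j$, so $\mathrm d e_j=u_j$. For $k\ge 0$ let $\mathrm U^{(k)}$ be the free $R$-module on the (formal) monomials $\tilde u_{i_1}\cdots\tilde u_{i_k}$ of degree $k$, and put $\mathbf Q^{(k)}_*=\mathbf K_*\otimes_R \mathrm U^{(k)}$ with $$\mathrm d_{\mathbf Q}^{(k)}(y\otimes m)=\mathrm d y\otimes m,\qquad \partial^{(k+1)}:\mathbf Q^{(k)}_{*}\to\mathbf Q^{(k+1)}_{*-1},\quad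 \partial^{(k+1)}(y\otimes m)=\sum_j y_j\otimes(\tilde u_j m).$$ Let $\mathbf K(R;I^s)_*=\mathbf Q^{(0)}_*\oplus\cdots\oplus\mathbf Q^{(s-1)}_*$. For a sign $\theta\in\{1,-1\}$ let $\mathrm d^{(s)}_\theta(x_0,\dots,x_{s-1})=(x_0',\dots,x_{s-1}')$, where $$x_0'=\mathrm d_{\mathbf Q}^{(0)}x_0,\qquad x_k'=\theta\,\partial^{(k)}x_{k-1}+\mathrm d_{\mathbf Q}^{(k)}x_k\quad(1\le k\le s-1),$$ and let $\epsilon^{(s)}_\theta:\mathbf K(R;I^s)_0\to R/I^s$ be the $R$-linear map $$\epsilon^{(s)}_\theta(a_0,\dots,a_{s-1})=\sum_{k=0}^{s-1}(-\theta)^k\,a_k(u)\ \bmod I^s,$$ where $a_k\in\mathbf Q^{(k)}_0=\mathrm U^{(k)}$ and $a_k(u)\in R$ is obtained by replacing each monomial $\tilde u_{i_1}\cdots\tilde u_{i_k}$ by the product $u_{i_1}\cdots u_{i_k}$. Then for each choice of the sign $\theta$, $$\cdots\to\mathbf K(R;I^s)_2\xrightarrow{\mathrm d^{(s)}_\theta}\mathbf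 K(R;I^s)_1\xrightarrow{\mathrm d^{(s)}_\theta}\mathbf K(R;I^s)_0\xrightarrow{\epsilon^{(s)}_\theta}R/I^s\to 0$$ is a resolution of $R/I^s$ by free $R$-modules: every $\mathbf K(R;I^s)_n$ is free and the sequence is a complex and is exact. -/

import Mathlib

open scoped TensorProduct

noncomputable section

/-- The index set of a sequence of length `N`, where `N` is a natural number (finite sequences)
or `⊤` (sequences indexed by all of `ℕ`). Indices start at `0`. -/
abbrev SeqIndex (N : ℕ∞) : Type := {i : ℕ // (i : ℕ∞) < N}

/-- Each `u i` is a non-zero-divisor on the quotient of `R` by the ideal generated by the earlier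
terms. (The further requirement `R / (u) ≠ 0`, which some authors make, is not imposed.) -/
def IsRegularSequence {R : Type*} [CommRing R] {N : ℕ∞} (u : SeqIndex N → R) : Prop :=
  ∀ i : SeqIndex N, IsSMulRegular (R ⧸ Ideal.span (u '' {j | j < i})) (u i)

namespace PowerKoszul

variable (R : Type*) [CommRing R] (ι : Type*)

/-- The degree `n` part `K_n` of the exterior algebra `Λ_R(e_i : i)` on the free module with
basis `e_i = Finsupp.single i 1`. -/
def Koszul (n : ℕ) : Type _ := ⋀[R]^n (ι →₀ R)

instance (n : ℕ) : AddCommGroup (Koszul R ι n) :=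
  inferInstanceAs (AddCommGroup (⋀[R]^n (ι →₀ R)))

instance (n : ℕ) : Module R (Koszul R ι n) :=
  inferInstanceAs (Module R (⋀[R]^n (ι →₀ R)))

/-- The identity map, between `K_n` and Mathlib's exterior power. -/
def koszulEquiv (n : ℕ) : Koszul R ι n ≃ₗ[R] ⋀[R]^n (ι →₀ R) where
  toFun x := x
  invFun x := x
  map_add' _ _ := rfl
  map_smul' _ _ := rfl
  left_inv _ := rfl
  right_inv _ := rfl

/-- `(x_1, …, x_n) ↦ x_1 ∧ ⋯ ∧ x_n`. -/
def wedge (n : ℕ) : (ι →₀ R) [⋀^Fin n]→ₗ[R] Koszul R ι n :=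
  (koszulEquiv R ι n).symm.toLinearMap.compAlternatingMap (exteriorPower.ιMulti R n)

/-- `U^(k)`: the free module on the monomials of degree `k` in indeterminates indexed by `ι`. -/
abbrev Mono (k : ℕ) : Type _ := Sym ι k →₀ R

/-- `Q^(k)_n = K_n ⊗ U^(k)`. -/
abbrev Q (k n : ℕ) : Type _ := Koszul R ι n ⊗[R] Mono R ι k

/-- `K(R; I^s)_n = Q^(0)_n ⊕ ⋯ ⊕ Q^(s-1)_n`. -/
abbrev Res (s n : ℕ) : Type _ := (k : Fin s) → Q R ι (k : ℕ) n

/-- The formal boundary `y ↦ ∑ j, y_j ⊗ e_j`, where the Koszul differential is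
`d y = ∑ j, u_j y_j`. Explicitly
`x_0 ∧ ⋯ ∧ x_n ↦ ∑ i, (-1)^i (x_0 ∧ ⋯ ∧ x_{i-1} ∧ x_{i+1} ∧ ⋯ ∧ x_n) ⊗ x_i`. -/
def formalBoundary (n : ℕ) : Koszul R ι (n + 1) →ₗ[R] Koszul R ι n ⊗[R] (ι →₀ R) :=
  exteriorPower.alternatingMapLinearEquiv
    (AlternatingMap.alternatizeUncurryFin
      { toFun := fun x =>
          ((TensorProduct.mk R (Koszul R ι n) (ι →₀ R)).flip x).compAlternatingMap (wedge R ι n)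
        map_add' := fun x y => AlternatingMap.ext fun v => by simp
        map_smul' := fun c x => AlternatingMap.ext fun v => by simp })
    ∘ₗ (koszulEquiv R ι (n + 1)).toLinearMap

/-- Multiplication of a monomial by a variable, `e_j ⊗ m ↦ u_j m`. -/
def varMul (k : ℕ) : (ι →₀ R) →ₗ[R] Mono R ι k →ₗ[R] Mono R ι (k + 1) :=
  Finsupp.linearCombination R fun j => Finsupp.lmapDomain R R (Sym.cons j)

/-- The map `∂^(k+1) : Q^(k)_{n+1} → Q^(k+1)_n`, sending `y ⊗ m` to `∑ j, y_j ⊗ (u_j m)`. -/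
def del (k n : ℕ) : Q R ι k (n + 1) →ₗ[R] Q R ι (k + 1) n :=
  (TensorProduct.lift (varMul R ι k)).lTensor (Koszul R ι n)
    ∘ₗ (TensorProduct.assoc R (Koszul R ι n) (ι →₀ R) (Mono R ι k)).toLinearMap
    ∘ₗ (formalBoundary R ι n).rTensor (Mono R ι k)

variable {R ι} (u : ι → R)

/-- The Koszul differential `d y = ∑ j, u_j y_j`, with `d e_j = u_j`. -/
def koszulD (n : ℕ) : Koszul R ι (n + 1) →ₗ[R] Koszul R ι n :=
  (TensorProduct.rid R (Koszul R ι n)).toLinearMap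
    ∘ₗ (Finsupp.linearCombination R u).lTensor (Koszul R ι n)
    ∘ₗ formalBoundary R ι n

/-- The differential `d ⊗ 1` of `Q^(k) = K ⊗ U^(k)`. -/
def dQ (k n : ℕ) : Q R ι k (n + 1) →ₗ[R] Q R ι k n :=
  (koszulD u n).rTensor (Mono R ι k)

/-- The twisted differential `x ↦ x'`, `x'_0 = d_Q x_0` and `x'_k = θ ∂^(k) x_{k-1} + d_Q x_k` for
`1 ≤ k < s`, where `θ` is a sign. -/
def twistedD (θ : ℤˣ) (s n : ℕ) : Res R ι s (n + 1) →ₗ[R] Res R ι s n :=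
  LinearMap.pi fun k => match k with
    | ⟨0, h⟩ => dQ u 0 n ∘ₗ LinearMap.proj (⟨0, h⟩ : Fin s)
    | ⟨k + 1, h⟩ =>
        ((θ : ℤ) : R) • (del R ι k n ∘ₗ LinearMap.proj (⟨k, Nat.lt_of_succ_lt h⟩ : Fin s))
          + dQ u (k + 1) n ∘ₗ LinearMap.proj (⟨k + 1, h⟩ : Fin s)

/-- Evaluation `Q^(k)_0 = U^(k) → R` of the variables at `u`:
`∑ a_m m ↦ ∑ a_m u_{i_1} ⋯ u_{i_k}`, where `m` is the monomial of `i_1, …, i_k`. -/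
def evalMono (k : ℕ) : Q R ι k 0 →ₗ[R] R :=
  Finsupp.linearCombination R (fun m : Sym ι k => ((m : Multiset ι).map u).prod)
    ∘ₗ (TensorProduct.lid R (Mono R ι k)).toLinearMap
    ∘ₗ ((exteriorPower.zeroEquiv R (ι →₀ R)).toLinearMap ∘ₗ (koszulEquiv R ι 0).toLinearMap).rTensor
        (Mono R ι k)

/-- The augmentation `K(R; I^s)_0 → R / I^s`, `I = (u)`, sending `(a_0, …, a_{s-1})` to the class of
`∑ k, (-θ)^k a_k(u)`, where `θ` is a sign. -/
def augmentation (θ : ℤˣ) (s : ℕ) :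
    Res R ι s 0 →ₗ[R] R ⧸ (Ideal.span (Set.range u)) ^ s :=
  ((Ideal.span (Set.range u)) ^ s).mkQ
    ∘ₗ ∑ k : Fin s, (-((θ : ℤ) : R)) ^ (k : ℕ) • (evalMono u (k : ℕ) ∘ₗ LinearMap.proj k)

end PowerKoszul

end

/-!
The resolution of `R / I^s` rests on two facts of different nature.

*Positive degrees.* The differential of `K(R; I^s)` is triangular with respect to the
decomposition into the `Q^(k)`, with `dQ` on the diagonal, so a cycle is lifted one component at a
time (`twistedD_exact_of_koszulD_exact`): after subtracting a boundary the first nonzero component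
is a `dQ`-cycle, and `dQ = d ⊗ 1` is exact in positive degrees because the Koszul complex is and
`U^(k)` is free. That the differential squares to zero follows from one principle,
`contraction_comp_add_eq_zero`: all the maps involved are contractions
`y ⊗ m ↦ ∑ j, y_j ⊗ T_j m`, and contracting twice is antisymmetric in the two indices.

*Acyclicity of the Koszul complex* (`koszulD_exact`). On the whole exterior algebra, `d` is the
contraction by the linear form `e_j ↦ u_j`. The exterior algebra is the union of the subalgebras
`A_i` generated by `e_0, …, e_{i-1}`, with `A_{i+1} = A_i ⊕ e_i A_i`, and by induction on `i` every
cycle in `A_i` is the sum of a scalar and of the boundary of an element of `A_i`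
(`ExteriorAlgebra.exists_contractLeft_add_algebraMap_of_mem_stage`). For a cycle `a + e_i b`, both
`d b = 0` and `d a + u_i b = 0`; thus `b = d c + β` with `β` a scalar such that
`u_i β ∈ (u_0, …, u_{i-1})`, regularity puts `β` into that ideal, so that `b = d c'`, and
`a + e_i b + d (e_i c') = a + u_i c'` is a cycle in `A_i`. Taking homogeneous components gives the
graded statement.

*Degree zero* (`twistedD_augmentation_exact`) needs no regularity. Modulo boundaries, a monomial
`ũ_j m` of degree `k + 1 < s` equals `-θ u_j m`, and `u_j m` is a boundary when `m` has degree
`s - 1`. Hence every element is congruent to its signed evaluation times the empty monomial, and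
`I^s`, being spanned by the monomials of degree `s` in the `u_i`, annihilates the empty monomial.
-/

noncomputable section

open scoped TensorProduct

/-! ### Contractions in the exterior algebra -/

namespace ExteriorAlgebra
open CliffordAlgebra (contractLeft)
variable {R M : Type*} [CommRing R] [AddCommGroup M] [Module R M]

/-- The Leibniz rule `CliffordAlgebra.contractLeft_ι_mul` in terms of `ExteriorAlgebra.ι`. -/
theorem contractLeft_ι_mul (φ : Module.Dual R M) (m : M) (z : ExteriorAlgebra R M) :
    contractLeft φ (ι R m * z) = φ m • z - ι R m * contractLeft φ z :=
  CliffordAlgebra.contractLeft_ι_mul (Q := 0) (d := φ) m z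

theorem contractLeft_ιMulti (φ : Module.Dual R M) {n : ℕ} (v : Fin (n + 1) → M) :
    contractLeft φ (ιMulti R (n + 1) v) =
      ∑ i : Fin (n + 1), (-1 : ℤ) ^ (i : ℕ) • φ (v i) • ιMulti R n (i.removeNth v) := by
  induction n with
  | zero =>
    rw [ιMulti_succ_apply, contractLeft_ι_mul]
    simp [CliffordAlgebra.contractLeft_one]
  | succ n ih =>
    rw [ιMulti_succ_apply, contractLeft_ι_mul]
    simp only [Matrix.vecTail, Function.comp_def]
    rw [ih, Finset.mul_sum, sub_eq_add_neg, ← Finset.sum_neg_distrib,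
      Fin.sum_univ_succ (n := n + 1)]
    congr 1
    · simp only [Fin.val_zero, pow_zero, one_smul, Fin.removeNth_zero]
      rfl
    · refine Finset.sum_congr rfl fun i _ => ?_
      have hi : ιMulti R (n + 1) (i.succ.removeNth v) =
          ι R (v 0) * ιMulti R n (i.removeNth fun x => v x.succ) := by
        rw [ιMulti_succ_apply]
        simp only [Fin.removeNth, Matrix.vecTail, Function.comp_def, Fin.succ_succAbove_zero,
          Fin.succ_succAbove_succ]
        rfl
      rw [hi, mul_smul_comm, mul_smul_comm, Fin.val_succ, pow_succ, mul_neg_one, neg_smul]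

/-- Contraction by a linear form is homogeneous of degree `-1`. -/
theorem proj_contractLeft (φ : Module.Dual R M) (n : ℕ)
    (z : ExteriorAlgebra R M) :
    GradedAlgebra.proj (fun i : ℕ => ⋀[R]^i M) n (contractLeft φ z) =
      contractLeft φ (GradedAlgebra.proj (fun i : ℕ => ⋀[R]^i M) (n + 1) z) := by
  have key : ∀ {m k : ℕ} {x : ExteriorAlgebra R M}, x ∈ ⋀[R]^m M →
      GradedAlgebra.proj (fun i : ℕ => ⋀[R]^i M) k x = if m = k then x else 0 := by
    intro m k x hx
    rw [GradedAlgebra.proj_apply]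
    split_ifs with h
    · subst h
      exact DirectSum.decompose_of_mem_same _ hx
    · exact DirectSum.decompose_of_mem_ne _ hx h
  have hz : z ∈ Submodule.span R
      (Set.range fun x : Σ n, (Fin n → M) => ιMulti R x.1 x.2) := by
    rw [ιMulti_span]
    exact Submodule.mem_top
  induction hz using Submodule.span_induction with
  | mem _ h =>
    obtain ⟨⟨m, v⟩, rfl⟩ := h
    have hmem : ∀ {m : ℕ} (v : Fin m → M), ιMulti R m v ∈ ⋀[R]^m M :=
      fun {m} v => ιMulti_range R m ⟨v, rfl⟩
    dsimp only
    rw [key (hmem v)]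
    cases m with
    | zero => simp [CliffordAlgebra.contractLeft_one]
    | succ m =>
      have hd : contractLeft φ (ιMulti R (m + 1) v) ∈ ⋀[R]^m M := by
        rw [contractLeft_ιMulti]
        exact Submodule.sum_mem _ fun i _ =>
          zsmul_mem (Submodule.smul_mem _ _ (hmem _)) _
      rw [key hd]
      simp only [Nat.add_right_cancel_iff]
      split_ifs
      · rfl
      · rw [map_zero]
  | zero => simp
  | add x y _ _ hx hy => simp only [map_add, hx, hy]
  | smul c x _ hx => simp only [map_smul, hx]

/-! ### A filtration of the exterior algebra by subalgebras -/

/-- The underlying submodule of the subalgebra generated by `e 0, …, e (i - 1)`, built one vector at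
a time: `stage e (i + 1) = stage e i + e i ∧ stage e i`. -/
def stage (e : ℕ → M) : ℕ → Submodule R (ExteriorAlgebra R M)
  | 0 => 1
  | i + 1 => stage e i ⊔ (stage e i).map (LinearMap.mulLeft R (ι R (e i)))

theorem mem_stage_succ {e : ℕ → M} {i : ℕ} {z : ExteriorAlgebra R M} :
    z ∈ stage e (i + 1) ↔ ∃ a ∈ stage e i, ∃ b ∈ stage e i, a + ι R (e i) * b = z := by
  simp [stage, Submodule.mem_sup]

theorem stage_mono (e : ℕ → M) : Monotone (stage (R := R) e) :=
  monotone_nat_of_le_succ fun _ => le_sup_left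

theorem one_mem_stage (e : ℕ → M) (i : ℕ) : (1 : ExteriorAlgebra R M) ∈ stage e i :=
  stage_mono e (Nat.zero_le i) (Submodule.one_le.1 le_rfl)

theorem ι_mul_mem_stage (e : ℕ → M) {i j : ℕ} (hj : j < i) {z : ExteriorAlgebra R M}
    (hz : z ∈ stage e i) : ι R (e j) * z ∈ stage e i := by
  induction i generalizing z with
  | zero => omega
  | succ i ih =>
    obtain ⟨a, ha, b, hb, rfl⟩ := mem_stage_succ.1 hz
    rcases Nat.lt_succ_iff_lt_or_eq.1 hj with h | rfl
    · refine mem_stage_succ.2 ⟨_, ih h ha, -(ι R (e j) * b), neg_mem (ih h hb), ?_⟩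
      rw [mul_add, ← mul_assoc (ι R (e j)), eq_neg_of_add_eq_zero_left (ι_add_mul_swap (e j) (e i)),
        neg_mul, mul_neg, mul_assoc]
    · refine mem_stage_succ.2 ⟨0, zero_mem _, a, ha, ?_⟩
      rw [mul_add, ← mul_assoc, ι_sq_zero]
      simp

theorem exists_mem_stage {e : ℕ → M} (he : Submodule.span R (Set.range e) = ⊤)
    (z : ExteriorAlgebra R M) : ∃ i, z ∈ stage e i := by
  let S : Submodule R (ExteriorAlgebra R M) := ⨆ i, stage e i
  have hS : ∀ {x}, x ∈ S ↔ ∃ i, x ∈ stage e i := fun {x} =>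
    Submodule.mem_iSup_of_directed _ (stage_mono e).directed_le
  have key : ∀ (m : M), ∀ x ∈ S, ι R m * x ∈ S := by
    intro m x hx
    have hm : m ∈ Submodule.span R (Set.range e) := he ▸ Submodule.mem_top
    induction hm using Submodule.span_induction with
    | mem _ h =>
      obtain ⟨j, rfl⟩ := h
      obtain ⟨i, hi⟩ := hS.1 hx
      exact hS.2 ⟨max i (j + 1), ι_mul_mem_stage e (by omega) (stage_mono e (le_max_left _ _) hi)⟩
    | zero => simp
    | add x y _ _ hx hy => rw [map_add, add_mul]; exact add_mem hx hy
    | smul c x _ hx => rw [map_smul, smul_mul_assoc]; exact S.smul_mem c hx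
  refine hS.1 ?_
  induction z using CliffordAlgebra.left_induction with
  | algebraMap r =>
    rw [Algebra.algebraMap_eq_smul_one]
    exact S.smul_mem r (hS.2 ⟨0, one_mem_stage e 0⟩)
  | add x y hx hy => exact add_mem hx hy
  | ι_mul x m hx => exact key m x hx

theorem contractLeft_mem_stage (e : ℕ → M) (φ : Module.Dual R M) {i : ℕ}
    {z : ExteriorAlgebra R M} (hz : z ∈ stage e i) : contractLeft φ z ∈ stage e i := by
  induction i generalizing z with
  | zero =>
    obtain ⟨r, rfl⟩ := Submodule.mem_one.1 hz
    rw [CliffordAlgebra.contractLeft_algebraMap]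
    exact zero_mem _
  | succ i ih =>
    obtain ⟨a, ha, b, hb, rfl⟩ := mem_stage_succ.1 hz
    refine mem_stage_succ.2
      ⟨_, add_mem (ih ha) (Submodule.smul_mem _ (φ (e i)) hb), _, neg_mem (ih hb), ?_⟩
    rw [map_add, contractLeft_ι_mul]
    noncomm_ring

/-- A linear form vanishing on `e 0, …, e (i - 1)` contracts `stage e i` to zero. Applied to a
coordinate form at `i`, it separates the two summands of `stage e (i + 1)`. -/
theorem contractLeft_eq_zero_of_mem_stage {e : ℕ → M} {ψ : Module.Dual R M} {i : ℕ}
    (hψ : ∀ j < i, ψ (e j) = 0) {z : ExteriorAlgebra R M} (hz : z ∈ stage e i) :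
    contractLeft ψ z = 0 := by
  induction i generalizing z with
  | zero =>
    obtain ⟨r, rfl⟩ := Submodule.mem_one.1 hz
    exact CliffordAlgebra.contractLeft_algebraMap (Q := 0) ψ r
  | succ i ih =>
    obtain ⟨a, ha, b, hb, rfl⟩ := mem_stage_succ.1 hz
    have hψ' : ∀ j < i, ψ (e j) = 0 := fun j hj => hψ j (by omega)
    rw [map_add, contractLeft_ι_mul, ih hψ' ha, ih hψ' hb, hψ i (by omega)]
    simp

/-- The degree zero part of a boundary of `stage e i` lies in the ideal generated by the values of
`φ` at `e 0, …, e (i - 1)`. -/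
theorem algebraMapInv_contractLeft_mem {e : ℕ → M} (φ : Module.Dual R M) {i : ℕ}
    {z : ExteriorAlgebra R M} (hz : z ∈ stage e i) :
    algebraMapInv (contractLeft φ z) ∈ Ideal.span ((fun j => φ (e j)) '' Set.Iio i) := by
  induction i generalizing z with
  | zero =>
    obtain ⟨r, rfl⟩ := Submodule.mem_one.1 hz
    simp [CliffordAlgebra.contractLeft_algebraMap]
  | succ i ih =>
    obtain ⟨a, ha, b, hb, rfl⟩ := mem_stage_succ.1 hz
    rw [map_add, contractLeft_ι_mul, map_add, map_sub, map_smul, map_mul]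
    have h0 : algebraMapInv (R := R) (M := M) (ι R (e i)) = 0 := by simp [algebraMapInv]
    rw [h0, zero_mul, sub_zero]
    refine add_mem
      (Ideal.span_mono (Set.image_mono (Set.Iio_subset_Iio (Nat.le_succ i))) (ih ha)) ?_
    exact Ideal.mul_mem_right _ _ (Ideal.subset_span ⟨i, by simp, rfl⟩)

/-- Conversely, every scalar in that ideal is a boundary of `stage e i`. -/
theorem exists_contractLeft_eq_algebraMap {e : ℕ → M} (φ : Module.Dual R M) {i : ℕ} {r : R}
    (hr : r ∈ Ideal.span ((fun j => φ (e j)) '' Set.Iio i)) :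
    ∃ v ∈ stage e i, contractLeft φ v = algebraMap R (ExteriorAlgebra R M) r := by
  induction hr using Submodule.span_induction with
  | mem _ h =>
    obtain ⟨j, hj, rfl⟩ := h
    exact ⟨ι R (e j), by simpa using ι_mul_mem_stage e hj (one_mem_stage e i),
      CliffordAlgebra.contractLeft_ι (Q := 0) φ (e j)⟩
  | zero => exact ⟨0, zero_mem _, by simp⟩
  | add x y _ _ hx hy =>
    obtain ⟨v, hv, hv'⟩ := hx
    obtain ⟨w, hw, hw'⟩ := hy
    exact ⟨v + w, add_mem hv hw, by rw [map_add, map_add, hv', hw']⟩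
  | smul c x _ hx =>
    obtain ⟨v, hv, hv'⟩ := hx
    exact ⟨c • v, Submodule.smul_mem _ _ hv, by
      rw [map_smul, hv', smul_eq_mul, map_mul, Algebra.smul_def]⟩

/-- Cycles are sums of boundaries and scalars, for an ungraded Koszul complex. Zero vectors are
allowed in the family `e`, so that a finite basis can be continued by zeros to an infinite family;
the existence of `ψ` says that `e i` splits off from the span of the preceding vectors. -/
theorem exists_contractLeft_add_algebraMap_of_mem_stage {e : ℕ → M} {φ : Module.Dual R M}
    (h : ∀ i, e i = 0 ∨ ((∃ ψ : Module.Dual R M, ψ (e i) = 1 ∧ ∀ j < i, ψ (e j) = 0) ∧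
      IsSMulRegular (R ⧸ Ideal.span ((fun j => φ (e j)) '' Set.Iio i)) (φ (e i))))
    {i : ℕ} {z : ExteriorAlgebra R M} (hz : z ∈ stage e i) (hdz : contractLeft φ z = 0) :
    ∃ w ∈ stage e i, ∃ r : R, z = contractLeft φ w + algebraMap R (ExteriorAlgebra R M) r := by
  induction i generalizing z with
  | zero =>
    obtain ⟨r, rfl⟩ := Submodule.mem_one.1 hz
    exact ⟨0, zero_mem _, r, by simp⟩
  | succ i ih =>
    obtain ⟨a, ha, b, hb, rfl⟩ := mem_stage_succ.1 hz
    have hsub := stage_mono (R := R) e (Nat.le_succ i)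
    rcases h i with h0 | ⟨⟨ψ, hψ1, hψ⟩, hreg⟩
    · obtain ⟨w, hw, r, hwr⟩ := ih ha (by simpa [h0] using hdz)
      exact ⟨w, hsub hw, r, by simpa [h0] using hwr⟩
    have hd : contractLeft φ a + (φ (e i) • b - ι R (e i) * contractLeft φ b) = 0 := by
      rw [← contractLeft_ι_mul, ← hdz, map_add]
    -- contracting `hd` by `ψ` isolates the coefficient of `e i`
    have hdb : contractLeft φ b = 0 := by
      have := congrArg (contractLeft ψ) hd
      have e1 := contractLeft_eq_zero_of_mem_stage hψ (contractLeft_mem_stage e φ ha)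
      have e2 := contractLeft_eq_zero_of_mem_stage hψ hb
      have e3 := contractLeft_eq_zero_of_mem_stage hψ (contractLeft_mem_stage e φ hb)
      have e4 := contractLeft_ι_mul ψ (e i) (contractLeft φ b)
      rw [e3, hψ1, one_smul, mul_zero, sub_zero] at e4
      rw [map_add, map_sub, map_smul, e1, e2, smul_zero, zero_add, zero_sub, map_zero] at this
      rw [← e4]
      exact neg_eq_zero.1 this
    rw [hdb, mul_zero, sub_zero] at hd
    obtain ⟨c, hc, β, rfl⟩ := ih hb hdb
    -- the degree zero part of `hd` gives `φ (e i) * β ∈ (φ (e j) : j < i)`, and `φ (e i)` is regular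
    have hβ : β ∈ Ideal.span ((fun j => φ (e j)) '' Set.Iio i) := by
      have h1 := algebraMapInv_contractLeft_mem φ
        (add_mem ha (Submodule.smul_mem _ (φ (e i)) hc))
      have h2 : contractLeft φ (a + φ (e i) • c) =
          algebraMap R (ExteriorAlgebra R M) (-(φ (e i) * β)) := by
        rw [map_add, map_smul, map_neg, map_mul, ← Algebra.smul_def, eq_neg_iff_add_eq_zero,
          ← hd, smul_add, add_assoc]
      rw [h2, algebraMap_leftInverse, neg_mem_iff] at h1
      rw [← Ideal.Quotient.eq_zero_iff_mem]
      refine hreg ?_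
      change φ (e i) • Ideal.Quotient.mk _ β = φ (e i) • (0 : R ⧸ _)
      rw [smul_zero, ← Ideal.Quotient.mk_eq_mk, ← Submodule.Quotient.mk_smul]
      exact (Submodule.Quotient.mk_eq_zero _).2 h1
    obtain ⟨v, hv, hv'⟩ := exists_contractLeft_eq_algebraMap (e := e) φ hβ
    -- now `b = d (c + v)`, and adding `d (e i ∧ (c + v))` moves the cycle into `stage e i`
    rw [← hv', ← map_add] at hd ⊢
    have hcv := add_mem hc hv
    generalize c + v = c at hd hcv
    obtain ⟨w, hw, r, hwr⟩ := ih (add_mem ha (Submodule.smul_mem _ (φ (e i)) hcv))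
      (by rw [map_add, map_smul, hd])
    refine ⟨w - ι R (e i) * c,
      sub_mem (hsub hw) (ι_mul_mem_stage e (Nat.lt_succ_self i) (hsub hcv)), r, ?_⟩
    rw [map_sub, contractLeft_ι_mul, eq_sub_of_add_eq hwr]
    abel

end ExteriorAlgebra

namespace PowerKoszul

/-! ### Acyclicity of the Koszul complex of a regular sequence -/

section

open CliffordAlgebra (contractLeft)
variable {R : Type*} [CommRing R] {ι : Type*}

/-- Linear maps on `Koszul R ι n` are determined by their values on wedge products. -/
theorem Koszul.hom_ext {P : Type*} [AddCommGroup P] [Module R P] {n : ℕ}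
    {f g : Koszul R ι n →ₗ[R] P} (h : ∀ v, f (wedge R ι n v) = g (wedge R ι n v)) : f = g :=
  exteriorPower.linearMap_ext (R := R) (M := ι →₀ R) (AlternatingMap.ext h)

theorem formalBoundary_wedge {n : ℕ} (v : Fin (n + 1) → ι →₀ R) :
    formalBoundary R ι n (wedge R ι (n + 1) v) =
      ∑ i : Fin (n + 1), (-1 : ℤ) ^ (i : ℕ) • (wedge R ι n (i.removeNth v) ⊗ₜ[R] v i) := by
  have : formalBoundary R ι n (wedge R ι (n + 1) v) = _ :=
    exteriorPower.alternatingMapLinearEquiv_apply_ιMulti _ v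
  rw [this, AlternatingMap.alternatizeUncurryFin_apply]
  rfl

/-- The inclusion of `K_n` in the exterior algebra. -/
def toExterior (n : ℕ) : Koszul R ι n →ₗ[R] ExteriorAlgebra R (ι →₀ R) :=
  (⋀[R]^n (ι →₀ R)).subtype ∘ₗ (koszulEquiv R ι n).toLinearMap

theorem toExterior_wedge {n : ℕ} (v : Fin n → ι →₀ R) :
    toExterior n (wedge R ι n v) = ExteriorAlgebra.ιMulti R n v := rfl

theorem toExterior_injective (n : ℕ) : Function.Injective (toExterior (R := R) (ι := ι) n) :=
  Subtype.val_injective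

/-- The Koszul differential is the contraction by the linear form `e_j ↦ u_j`. -/
theorem toExterior_koszulD (u : ι → R) {n : ℕ} (y : Koszul R ι (n + 1)) :
    toExterior n (koszulD u n y) =
      contractLeft (Finsupp.linearCombination R u) (toExterior (n + 1) y) := by
  suffices toExterior n ∘ₗ koszulD u n =
      (contractLeft (Finsupp.linearCombination R u)) ∘ₗ toExterior (n + 1) from
    LinearMap.congr_fun this y
  refine Koszul.hom_ext fun v => ?_
  have := ExteriorAlgebra.contractLeft_ιMulti (Finsupp.linearCombination R u) v
  simp only [LinearMap.comp_apply, toExterior_wedge]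
  refine Eq.trans ?_ this.symm
  simp [koszulD, formalBoundary_wedge, toExterior_wedge]

variable {N : ℕ∞} {u : SeqIndex N → R}

/-- The Koszul complex of a regular sequence is exact in positive degrees. -/
theorem koszulD_exact (hu : IsRegularSequence u) (n : ℕ) :
    Function.Exact (koszulD u (n + 1)) (koszulD u n) := by
  set φ := Finsupp.linearCombination R u with hφ
  intro y
  constructor
  · intro hy
    -- the standard basis, continued by zeros when the sequence is finite
    let e : ℕ → SeqIndex N →₀ R := fun i =>
      if h : (i : ℕ∞) < N then Finsupp.single ⟨i, h⟩ 1 else 0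
    have heq : ∀ j : SeqIndex N, e j = Finsupp.single j 1 := fun j => dif_pos j.2
    have hspan : Submodule.span R (Set.range e) = ⊤ := by
      rw [eq_top_iff, ← (Finsupp.basisSingleOne (R := R) (ι := SeqIndex N)).span_eq]
      refine Submodule.span_mono ?_
      rintro _ ⟨j, rfl⟩
      exact ⟨j, by simp [heq]⟩
    have hreg : ∀ i, e i = 0 ∨ ((∃ ψ : Module.Dual R (SeqIndex N →₀ R), ψ (e i) = 1 ∧
        ∀ j < i, ψ (e j) = 0) ∧
        IsSMulRegular (R ⧸ Ideal.span ((fun j => φ (e j)) '' Set.Iio i)) (φ (e i))) := by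
      intro i
      by_cases h : (i : ℕ∞) < N
      · right
        lift i to SeqIndex N using h
        refine ⟨⟨Finsupp.lapply i, by simp [heq], fun j hj => ?_⟩, ?_⟩
        · have hjN : (j : ℕ∞) < N := lt_trans (by exact_mod_cast hj) i.2
          lift j to SeqIndex N using hjN
          rw [heq]
          exact Finsupp.single_eq_of_ne (fun h => by simp [h] at hj)
        · have hφe : ∀ j : SeqIndex N, φ (e j) = u j := fun j => by simp [heq, hφ]
          have himage : (fun j => φ (e j)) '' Set.Iio (i : ℕ) = u '' {j | j < i} := by
            ext r
            constructor
            · rintro ⟨j, hj, rfl⟩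
              have hjN : (j : ℕ∞) < N := lt_trans (by exact_mod_cast hj) i.2
              lift j to SeqIndex N using hjN
              exact ⟨j, hj, (hφe j).symm⟩
            · rintro ⟨j, hj, rfl⟩
              exact ⟨j, hj, hφe j⟩
          rw [himage, hφe]
          exact hu i
      · exact Or.inl (dif_neg h)
    obtain ⟨i, hi⟩ := ExteriorAlgebra.exists_mem_stage hspan (toExterior (n + 1) y)
    obtain ⟨w, -, r, hw⟩ := ExteriorAlgebra.exists_contractLeft_add_algebraMap_of_mem_stage hreg hi
      (by rw [← toExterior_koszulD, hy, map_zero])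
    -- comparing components of degree `n + 1` removes the scalar, which has degree zero
    let p := GradedAlgebra.proj (fun i : ℕ => ⋀[R]^i (SeqIndex N →₀ R))
    have hp : p (n + 1) (toExterior (n + 1) y) = toExterior (n + 1) y :=
      DirectSum.decompose_of_mem_same (fun i : ℕ => ⋀[R]^i (SeqIndex N →₀ R))
        (koszulEquiv R _ (n + 1) y).2
    have hr : p (n + 1) (algebraMap R _ r) = 0 :=
      DirectSum.decompose_of_mem_ne (fun i : ℕ => ⋀[R]^i (SeqIndex N →₀ R))
        (SetLike.algebraMap_mem_graded _ r) (Nat.succ_ne_zero n).symm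
    refine ⟨(koszulEquiv R _ (n + 2)).symm (DirectSum.decompose
      (fun i : ℕ => ⋀[R]^i (SeqIndex N →₀ R)) w (n + 2)), toExterior_injective _ ?_⟩
    rw [toExterior_koszulD, ← hp, hw, map_add, hr, add_zero]
    exact (ExteriorAlgebra.proj_contractLeft φ (n + 1) w).symm
  · rintro ⟨x, rfl⟩
    apply toExterior_injective
    rw [toExterior_koszulD, toExterior_koszulD, map_zero]
    exact CliffordAlgebra.contractLeft_contractLeft _ _

end

/-! ### Contractions with coefficients -/

section

variable {R : Type*} [CommRing R] {ι : Type*}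
variable {M M' M'' : Type*} [AddCommGroup M] [Module R M] [AddCommGroup M'] [Module R M']
  [AddCommGroup M''] [Module R M'']

/-- The contraction `y ⊗ m ↦ ∑ j, y_j ⊗ T e_j m` attached to a linear family `T` of maps of
coefficient modules. Both `dQ` and `del` are of this form. -/
def contraction (T : (ι →₀ R) →ₗ[R] M →ₗ[R] M') (n : ℕ) :
    Koszul R ι (n + 1) ⊗[R] M →ₗ[R] Koszul R ι n ⊗[R] M' :=
  (TensorProduct.lift T).lTensor (Koszul R ι n)
    ∘ₗ (TensorProduct.assoc R (Koszul R ι n) (ι →₀ R) M).toLinearMap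
    ∘ₗ (formalBoundary R ι n).rTensor M

theorem contraction_wedge (T : (ι →₀ R) →ₗ[R] M →ₗ[R] M') {n : ℕ} (v : Fin (n + 1) → ι →₀ R)
    (m : M) : contraction T n (wedge R ι (n + 1) v ⊗ₜ m) =
      ∑ i : Fin (n + 1), (-1 : ℤ) ^ (i : ℕ) • (wedge R ι n (i.removeNth v) ⊗ₜ[R] T (v i) m) := by
  simp only [contraction, LinearMap.comp_apply, LinearMap.rTensor_tmul, formalBoundary_wedge,
    TensorProduct.sum_tmul, map_sum]
  refine Finset.sum_congr rfl fun i _ => ?_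
  rw [← TensorProduct.smul_tmul', LinearMap.map_smul_of_tower, LinearMap.map_smul_of_tower]
  simp

theorem tensor_hom_ext {P : Type*} [AddCommGroup P] [Module R P] {n : ℕ}
    {f g : Koszul R ι n ⊗[R] M →ₗ[R] P}
    (h : ∀ v m, f (wedge R ι n v ⊗ₜ m) = g (wedge R ι n v ⊗ₜ m)) : f = g := by
  apply TensorProduct.ext
  refine Koszul.hom_ext fun v => ?_
  ext m
  exact h v m

/-- A sum of two composites of contractions vanishes if the corresponding sum of composites of
coefficient maps is symmetric in the two vectors that are removed. -/
theorem contraction_comp_add_eq_zero {M₁ : Type*} [AddCommGroup M₁] [Module R M₁]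
    {T : (ι →₀ R) →ₗ[R] M →ₗ[R] M'} {S : (ι →₀ R) →ₗ[R] M' →ₗ[R] M''}
    {T' : (ι →₀ R) →ₗ[R] M →ₗ[R] M₁} {S' : (ι →₀ R) →ₗ[R] M₁ →ₗ[R] M''}
    (h : ∀ x y m, S y (T x m) + S' y (T' x m) = S x (T y m) + S' x (T' y m)) (n : ℕ) :
    contraction S n ∘ₗ contraction T (n + 1) + contraction S' n ∘ₗ contraction T' (n + 1) = 0 := by
  refine tensor_hom_ext fun v m => ?_
  -- the composite is the twice alternatized symmetric bilinear map `F`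
  let G : M'' →ₗ[R] (ι →₀ R) [⋀^Fin n]→ₗ[R] Koszul R ι n ⊗[R] M'' :=
    { toFun z := ((TensorProduct.mk R (Koszul R ι n) M'').flip z).compAlternatingMap (wedge R ι n)
      map_add' x y := AlternatingMap.ext fun v => by simp
      map_smul' c x := AlternatingMap.ext fun v => by simp }
  let F : (ι →₀ R) →ₗ[R] (ι →₀ R) →ₗ[R] (ι →₀ R) [⋀^Fin n]→ₗ[R] Koszul R ι n ⊗[R] M'' :=
    LinearMap.mk₂ R (fun x y => G (S y (T x m) + S' y (T' x m)))
      (fun x x' y => by simp only [map_add, LinearMap.add_apply]; abel)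
      (fun c x y => by simp only [map_smul, LinearMap.smul_apply, map_add, smul_add])
      (fun x y y' => by simp only [map_add, LinearMap.add_apply]; abel)
      (fun c x y => by simp only [map_smul, LinearMap.smul_apply, map_add, smul_add])
  have hF : ∀ x y, F x y = F y x := fun x y => congrArg G (h x y m)
  have := congrArg (fun A => A v)
    (AlternatingMap.alternatizeUncurryFin_alternatizeUncurryFinLM_comp_of_symmetric hF)
  refine Eq.trans ?_ this
  simp only [AlternatingMap.alternatizeUncurryFin_apply, LinearMap.add_apply, LinearMap.comp_apply,
    contraction_wedge, map_sum, map_zsmul, AlternatingMap.alternatizeUncurryFinLM_apply,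
    ← Finset.sum_add_distrib, ← smul_add]
  simp only [F, G, LinearMap.mk₂_apply, LinearMap.coe_mk, AddHom.coe_mk,
    LinearMap.compAlternatingMap_apply, LinearMap.flip_apply, TensorProduct.mk_apply,
    TensorProduct.tmul_add]

theorem contraction_comp_eq_zero
    {T : (ι →₀ R) →ₗ[R] M →ₗ[R] M'} {S : (ι →₀ R) →ₗ[R] M' →ₗ[R] M''}
    (h : ∀ x y m, S y (T x m) = S x (T y m)) (n : ℕ) :
    contraction S n ∘ₗ contraction T (n + 1) = 0 := by
  have h0 : contraction (0 : (ι →₀ R) →ₗ[R] M →ₗ[R] M') (n + 1) = 0 :=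
    tensor_hom_ext fun v m => by simp [contraction_wedge]
  simpa [h0] using contraction_comp_add_eq_zero (S := S) (T := T) (S' := S) (T' := 0)
    (fun x y m => by simpa using h x y m) n

variable (u : ι → R)

theorem del_eq_contraction (k n : ℕ) : del R ι k n = contraction (varMul R ι k) n := rfl

theorem dQ_eq_contraction (k n : ℕ) :
    dQ u k n =
      contraction ((LinearMap.lsmul R (Mono R ι k)) ∘ₗ Finsupp.linearCombination R u) n := by
  refine tensor_hom_ext fun v m => ?_
  rw [contraction_wedge]
  simp only [dQ, koszulD, LinearMap.rTensor_tmul, LinearMap.comp_apply, formalBoundary_wedge,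
    map_sum, TensorProduct.sum_tmul]
  refine Finset.sum_congr rfl fun i _ => ?_
  rw [LinearMap.map_smul_of_tower, LinearMap.map_smul_of_tower, ← TensorProduct.smul_tmul']
  simp [TensorProduct.smul_tmul']

theorem varMul_single_single (k : ℕ) (i : ι) (m : Sym ι k) (a c : R) :
    varMul R ι k (Finsupp.single i a) (Finsupp.single m c) =
      Finsupp.single (i ::ₛ m) (a * c) := by
  rw [varMul, Finsupp.linearCombination_single, LinearMap.smul_apply, Finsupp.lmapDomain_apply,
    Finsupp.mapDomain_single, Finsupp.smul_single, smul_eq_mul]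

theorem varMul_comm (k : ℕ) (x y : ι →₀ R) (m : Mono R ι k) :
    varMul R ι (k + 1) y (varMul R ι k x m) = varMul R ι (k + 1) x (varMul R ι k y m) := by
  induction x using Finsupp.induction_linear with
  | zero => simp
  | add x x' hx hx' => simp only [map_add, LinearMap.add_apply, hx, hx']
  | single i a =>
    induction y using Finsupp.induction_linear with
    | zero => simp
    | add x x' hx hx' => simp only [map_add, LinearMap.add_apply, hx, hx']
    | single j b =>
      induction m using Finsupp.induction_linear with
      | zero => simp
      | add x x' hx hx' => simp only [map_add, hx, hx']
      | single m c =>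
        rw [varMul_single_single, varMul_single_single, varMul_single_single,
          varMul_single_single, Sym.cons_swap, mul_left_comm]

theorem dQ_comp_dQ (k n : ℕ) : dQ u k n ∘ₗ dQ u k (n + 1) = 0 := by
  rw [dQ_eq_contraction, dQ_eq_contraction]
  exact contraction_comp_eq_zero (fun x y m => by simp [smul_smul, mul_comm]) n

theorem del_comp_del (k n : ℕ) : del R ι (k + 1) n ∘ₗ del R ι k (n + 1) = 0 :=
  contraction_comp_eq_zero (varMul_comm k) n

theorem dQ_comp_del_add (k n : ℕ) :
    dQ u (k + 1) n ∘ₗ del R ι k (n + 1) + del R ι k n ∘ₗ dQ u k (n + 1) = 0 := by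
  rw [dQ_eq_contraction, dQ_eq_contraction]
  exact contraction_comp_add_eq_zero (fun x y m => by simp [add_comm]) n

end

/-! ### The twisted complex in positive degrees -/

section

variable {R : Type*} [CommRing R] {ι : Type*} (u : ι → R) (θ : ℤˣ)

theorem twistedD_apply_zero {s n : ℕ} (x : Res R ι s (n + 1)) (h : 0 < s) :
    twistedD u θ s n x ⟨0, h⟩ = dQ u 0 n (x ⟨0, h⟩) := rfl

theorem twistedD_apply_succ {s n k : ℕ} (x : Res R ι s (n + 1)) (h : k + 1 < s) :
    twistedD u θ s n x ⟨k + 1, h⟩ =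
      ((θ : ℤ) : R) • del R ι k n (x ⟨k, Nat.lt_of_succ_lt h⟩) +
        dQ u (k + 1) n (x ⟨k + 1, h⟩) := rfl

/-- At the first component where `x` may be nonzero, the twisted differential is `dQ`. -/
theorem twistedD_apply_of_forall_lt {s n : ℕ} {x : Res R ι s (n + 1)} {k : Fin s}
    (hx : ∀ j < k, x j = 0) : twistedD u θ s n x k = dQ u k n (x k) := by
  obtain ⟨_ | k, h⟩ := k
  · rfl
  · rw [twistedD_apply_succ, hx ⟨k, _⟩ (Fin.mk_lt_mk.2 k.lt_succ_self), map_zero, smul_zero,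
      zero_add]

/-- The inclusion of the summand `Q^(k)_n` in `K(R; I^s)_n`. -/
def incl {s k : ℕ} (h : k < s) (n : ℕ) : Q R ι k n →ₗ[R] Res R ι s n :=
  LinearMap.single R (fun j : Fin s => Q R ι j n) ⟨k, h⟩

theorem incl_apply_self {s k n : ℕ} (h : k < s) (y : Q R ι k n) : incl h n y ⟨k, h⟩ = y :=
  Pi.single_eq_same (M := fun j : Fin s => Q R ι j n) ⟨k, h⟩ y

theorem incl_apply_of_ne {s k n : ℕ} (h : k < s) (y : Q R ι k n) {j : Fin s} (hj : (j : ℕ) ≠ k) :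
    incl h n y j = 0 :=
  Pi.single_eq_of_ne (M := fun j : Fin s => Q R ι j n) (i := ⟨k, h⟩)
    (fun e => hj (congrArg Fin.val e)) y

theorem twistedD_incl {s n k : ℕ} (h : k < s) (y : Q R ι k (n + 1)) :
    twistedD u θ s n (incl h (n + 1) y) = incl h n (dQ u k n y) +
      if h' : k + 1 < s then ((θ : ℤ) : R) • incl h' n (del R ι k n y) else 0 := by
  funext ⟨i, hi⟩
  rw [Pi.add_apply]
  rcases lt_trichotomy i k with hik | rfl | hik
  · rw [twistedD_apply_of_forall_lt u θ fun j hj =>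
        incl_apply_of_ne h y (lt_trans (Fin.lt_def.1 hj) hik).ne,
      incl_apply_of_ne h _ hik.ne, incl_apply_of_ne h _ hik.ne, map_zero, zero_add]
    split_ifs with h'
    · rw [Pi.smul_apply, incl_apply_of_ne h' _ (lt_trans hik k.lt_succ_self).ne, smul_zero]
    · rfl
  · rw [twistedD_apply_of_forall_lt u θ fun j hj =>
        incl_apply_of_ne h y (Fin.lt_def.1 hj).ne, incl_apply_self, incl_apply_self]
    split_ifs with h'
    · rw [Pi.smul_apply, incl_apply_of_ne h' _ i.lt_succ_self.ne, smul_zero, add_zero]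
    · exact (add_zero _).symm
  · obtain _ | i := i
    · omega
    rw [twistedD_apply_succ, incl_apply_of_ne h y (j := ⟨i + 1, hi⟩) hik.ne', map_zero, add_zero,
      incl_apply_of_ne h _ (j := ⟨i + 1, hi⟩) hik.ne', zero_add]
    obtain rfl | hki := eq_or_ne i k
    · rw [dif_pos hi, Pi.smul_apply, incl_apply_self, incl_apply_self]
    · rw [incl_apply_of_ne h y hki, map_zero, smul_zero]
      split_ifs with h'
      · rw [Pi.smul_apply, incl_apply_of_ne h' _ (fun e => hki (Nat.succ_injective e)), smul_zero]
      · rfl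

theorem twistedD_twistedD (s n : ℕ) (x : Res R ι s (n + 2)) :
    twistedD u θ s n (twistedD u θ s (n + 1) x) = 0 := by
  have h1 : ∀ k x, dQ u k n (dQ u k (n + 1) x) = 0 := fun k x =>
    LinearMap.congr_fun (dQ_comp_dQ u k n) x
  have h2 : ∀ k x, del R ι (k + 1) n (del R ι k (n + 1) x) = 0 := fun k x =>
    LinearMap.congr_fun (del_comp_del k n) x
  have h3 : ∀ k x, del R ι k n (dQ u k (n + 1) x) = - dQ u (k + 1) n (del R ι k (n + 1) x) :=
    fun k x => eq_neg_of_add_eq_zero_right (LinearMap.congr_fun (dQ_comp_del_add u k n) x)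
  funext ⟨k, h⟩
  rw [Pi.zero_apply]
  obtain _ | _ | k := k
  · rw [twistedD_apply_zero, twistedD_apply_zero, h1]
  · rw [twistedD_apply_succ, twistedD_apply_zero, twistedD_apply_succ, map_add, map_smul, h1, h3]
    simp
  · rw [twistedD_apply_succ, twistedD_apply_succ, twistedD_apply_succ, map_add, map_smul, map_add,
      map_smul, h1, h2, h3]
    simp

instance (n : ℕ) : Module.Free R (Koszul R ι n) :=
  inferInstanceAs (Module.Free R (⋀[R]^n (ι →₀ R)))

/-- Exactness of the Koszul complex in one degree implies that of the twisted complex in the same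
degree, by lifting a cycle component by component. -/
theorem twistedD_exact_of_koszulD_exact {n : ℕ}
    (hK : Function.Exact (koszulD u (n + 1)) (koszulD u n)) (s : ℕ) :
    Function.Exact (twistedD u θ s (n + 1)) (twistedD u θ s n) := by
  have hQ : ∀ k, Function.Exact (dQ u k (n + 1)) (dQ u k n) := fun k =>
    Module.Flat.rTensor_exact (Mono R ι k) hK
  intro x
  refine ⟨fun hx => ?_, ?_⟩
  · suffices ∀ t ≤ s, ∃ y, ∀ k : Fin s, (k : ℕ) < t → twistedD u θ s (n + 1) y k = x k by
      obtain ⟨y, hy⟩ := this s le_rfl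
      exact ⟨y, funext fun k => hy k k.2⟩
    -- correct a preimage of the components of index `< t` so that it also fits at `t`
    intro t ht
    induction t with
    | zero => exact ⟨0, fun k hk => absurd hk (Nat.not_lt_zero _)⟩
    | succ t ih =>
      obtain ⟨y, hy⟩ := ih (Nat.le_of_succ_le ht)
      have hz : ∀ j : Fin s, (j : ℕ) < t → (x - twistedD u θ s (n + 1) y) j = 0 := fun j hj => by
        rw [Pi.sub_apply, hy j hj, sub_self]
      have hd : dQ u t n ((x - twistedD u θ s (n + 1) y) ⟨t, ht⟩) = 0 := by
        rw [← twistedD_apply_of_forall_lt u θ (k := ⟨t, ht⟩) fun j hj => hz j hj, map_sub, hx,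
          twistedD_twistedD, sub_zero, Pi.zero_apply]
      obtain ⟨w, hw⟩ := (hQ t _).1 hd
      refine ⟨y + incl ht (n + 2) w, fun k hk => ?_⟩
      have hlt : ∀ j < k, incl ht (n + 2) w j = 0 := fun j hj =>
        incl_apply_of_ne ht w (lt_of_lt_of_le (Fin.lt_def.1 hj) (Nat.lt_succ_iff.1 hk)).ne
      rw [map_add, Pi.add_apply, twistedD_apply_of_forall_lt u θ hlt]
      rcases Nat.lt_succ_iff_lt_or_eq.1 hk with hkt | hkt
      · rw [hy k hkt, incl_apply_of_ne ht w hkt.ne, map_zero, add_zero]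
      · obtain ⟨k, hks⟩ := k
        obtain rfl : k = t := hkt
        rw [incl_apply_self, hw]
        exact add_sub_cancel _ _
  · rintro ⟨y, rfl⟩
    exact twistedD_twistedD u θ s n y

end

/-! ### The augmentation -/

section

variable {R : Type*} [CommRing R] {ι : Type*} (u : ι → R) (θ : ℤˣ)

/-- Evaluation of a homogeneous polynomial of degree `k` at `u`. -/
def evalPoly (k : ℕ) : Mono R ι k →ₗ[R] R :=
  Finsupp.linearCombination R fun m : Sym ι k => ((m : Multiset ι).map u).prod

theorem evalPoly_single {k : ℕ} (m : Sym ι k) (a : R) :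
    evalPoly u k (Finsupp.single m a) = a * ((m : Multiset ι).map u).prod :=
  Finsupp.linearCombination_single R a m

theorem prod_map_cons {k : ℕ} (i : ι) (m : Sym ι k) :
    (((i ::ₛ m : Sym ι (k + 1)) : Multiset ι).map u).prod =
      u i * ((m : Multiset ι).map u).prod := by
  rw [Sym.coe_cons, Multiset.map_cons, Multiset.prod_cons]

theorem evalMono_wedge {k : ℕ} (v : Fin 0 → ι →₀ R) (f : Mono R ι k) :
    evalMono u k (wedge R ι 0 v ⊗ₜ f) = evalPoly u k f := by
  have h : exteriorPower.zeroEquiv R (ι →₀ R) (koszulEquiv R ι 0 (wedge R ι 0 v)) = 1 :=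
    exteriorPower.zeroEquiv_ιMulti (R := R) (M := ι →₀ R) v
  simp [evalMono, h, evalPoly]

theorem evalPoly_varMul {k : ℕ} (x : ι →₀ R) (f : Mono R ι k) :
    evalPoly u (k + 1) (varMul R ι k x f) = Finsupp.linearCombination R u x * evalPoly u k f := by
  induction x using Finsupp.induction_linear with
  | zero => simp
  | add x x' hx hx' => simp only [map_add, LinearMap.add_apply, hx, hx', add_mul]
  | single i a =>
    induction f using Finsupp.induction_linear with
    | zero => simp
    | add x x' hx hx' => simp only [map_add, hx, hx', mul_add]
    | single m c =>
      rw [varMul_single_single, evalPoly_single, evalPoly_single, prod_map_cons,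
        Finsupp.linearCombination_single, smul_eq_mul]
      ring

/-- `I^k` is generated by the monomials of degree `k` in the generators of `I`. -/
theorem span_pow_eq_span_monomials (k : ℕ) :
    Ideal.span (Set.range u) ^ k =
      Ideal.span (Set.range fun m : Sym ι k => ((m : Multiset ι).map u).prod) := by
  induction k with
  | zero =>
    rw [pow_zero, Ideal.one_eq_top, eq_comm, Ideal.eq_top_iff_one]
    exact Ideal.subset_span ⟨Sym.nil, by simp⟩
  | succ k ih =>
    rw [pow_succ', ih, Ideal.span_mul_span']
    congr 1
    ext r
    rw [Set.mem_mul]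
    constructor
    · rintro ⟨_, ⟨i, rfl⟩, _, ⟨m, rfl⟩, rfl⟩
      exact ⟨i ::ₛ m, prod_map_cons u i m⟩
    · rintro ⟨m, rfl⟩
      obtain ⟨i, m, rfl⟩ := m.exists_eq_cons_of_succ
      exact ⟨_, ⟨i, rfl⟩, _, ⟨m, rfl⟩, (prod_map_cons u i m).symm⟩

theorem evalPoly_mem (k : ℕ) (f : Mono R ι k) :
    evalPoly u k f ∈ Ideal.span (Set.range u) ^ k := by
  rw [span_pow_eq_span_monomials, Ideal.span, ← Finsupp.range_linearCombination]
  exact ⟨f, rfl⟩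

/-- The lift `(a_k) ↦ ∑ k, (-θ)^k a_k(u)` of the augmentation to a map with values in `R`. -/
def signedEval (s : ℕ) : Res R ι s 0 →ₗ[R] R :=
  ∑ k : Fin s, (-((θ : ℤ) : R)) ^ (k : ℕ) • (evalMono u (k : ℕ) ∘ₗ LinearMap.proj k)

theorem augmentation_apply {s : ℕ} (x : Res R ι s 0) :
    augmentation u θ s x = Ideal.Quotient.mk _ (signedEval u θ s x) := rfl

/-- The inclusion of `U^(k) = Q^(k)_0` in `K(R; I^s)_0`. -/
def component (s : ℕ) {k : ℕ} (h : k < s) : Mono R ι k →ₗ[R] Res R ι s 0 :=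
  incl h 0 ∘ₗ TensorProduct.mk R (Koszul R ι 0) (Mono R ι k) (wedge R ι 0 0)

theorem signedEval_component {s k : ℕ} (h : k < s) (f : Mono R ι k) :
    signedEval u θ s (component s h f) = (-((θ : ℤ) : R)) ^ k * evalPoly u k f := by
  rw [signedEval, LinearMap.sum_apply, Finset.sum_eq_single ⟨k, h⟩]
  · rw [LinearMap.smul_apply, LinearMap.comp_apply, LinearMap.proj_apply, component,
      LinearMap.comp_apply, incl_apply_self, TensorProduct.mk_apply, evalMono_wedge, smul_eq_mul]
  · intro j _ hj
    rw [LinearMap.smul_apply, LinearMap.comp_apply, LinearMap.proj_apply, component,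
      LinearMap.comp_apply, incl_apply_of_ne h _ fun e => hj (Fin.ext e), map_zero, smul_zero]
  · exact fun h => absurd (Finset.mem_univ _) h

theorem sign_mul_self : ((θ : ℤ) : R) * ((θ : ℤ) : R) = 1 := by
  rw [← Int.cast_mul, Int.units_coe_mul_self, Int.cast_one]

/-- The differential from degree one to degree zero, `v ⊗ f ↦ u(v) f + θ ṽ f`, the second term being
cut off in the top summand. -/
theorem twistedD_incl_wedge {s k : ℕ} (h : k < s) (v : Fin 1 → ι →₀ R) (f : Mono R ι k) :
    twistedD u θ s 0 (incl h 1 (wedge R ι 1 v ⊗ₜ f)) =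
      Finsupp.linearCombination R u (v 0) • component s h f +
        if h' : k + 1 < s then ((θ : ℤ) : R) • component s h' (varMul R ι k (v 0) f) else 0 := by
  have h1 : dQ u k 0 (wedge R ι 1 v ⊗ₜ f) =
      Finsupp.linearCombination R u (v 0) • (wedge R ι 0 0 ⊗ₜ f) := by
    rw [dQ_eq_contraction, contraction_wedge, Fin.sum_univ_one, Fin.val_zero, pow_zero, one_smul,
      Subsingleton.elim (Fin.removeNth 0 v) 0]
    exact TensorProduct.tmul_smul _ _ _
  have h2 : del R ι k 0 (wedge R ι 1 v ⊗ₜ f) = wedge R ι 0 0 ⊗ₜ varMul R ι k (v 0) f := by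
    rw [del_eq_contraction, contraction_wedge, Fin.sum_univ_one, Fin.val_zero, pow_zero, one_smul,
      Subsingleton.elim (Fin.removeNth 0 v) 0]
  rw [twistedD_incl, h1, h2, map_smul]
  rfl

/-- Linear maps on `K(R; I^s)_n` are determined by their values on elementary tensors in the
summands. -/
theorem Res.hom_ext {P : Type*} [AddCommGroup P] [Module R P] {s n : ℕ}
    {f g : Res R ι s n →ₗ[R] P}
    (h : ∀ k (hk : k < s) v m,
      f (incl hk n (wedge R ι n v ⊗ₜ m)) = g (incl hk n (wedge R ι n v ⊗ₜ m))) : f = g :=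
  LinearMap.pi_ext' fun ⟨k, hk⟩ => tensor_hom_ext (h k hk)

/-- The augmentation kills boundaries: the two terms of `d (y ⊗ f)` cancel, except when `f` has the
top degree `s - 1`, where the only term lies in `I^s`. -/
theorem signedEval_twistedD_mem {s : ℕ} (x : Res R ι s 1) :
    signedEval u θ s (twistedD u θ s 0 x) ∈ Ideal.span (Set.range u) ^ s := by
  rw [← Ideal.Quotient.eq_zero_iff_mem]
  suffices augmentation u θ s ∘ₗ twistedD u θ s 0 = 0 from LinearMap.congr_fun this x
  refine Res.hom_ext fun k hk v f => ?_
  rw [LinearMap.zero_apply, LinearMap.comp_apply, twistedD_incl_wedge, augmentation_apply,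
    Ideal.Quotient.eq_zero_iff_mem, map_add, map_smul, signedEval_component]
  split_ifs with h'
  · rw [map_smul, signedEval_component, evalPoly_varMul]
    convert Submodule.zero_mem _
    simp only [smul_eq_mul]
    linear_combination (-(-((θ : ℤ) : R)) ^ k * Finsupp.linearCombination R u (v 0) *
      evalPoly u k f) * sign_mul_self (R := R) θ
  · obtain rfl : k + 1 = s := by omega
    rw [map_zero, add_zero, smul_eq_mul, mul_left_comm, pow_succ']
    refine Ideal.mul_mem_left _ _ (Ideal.mul_mem_mul ?_ (evalPoly_mem u k f))
    rw [Ideal.span, ← Finsupp.range_linearCombination]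
    exact ⟨_, rfl⟩

/-- The element of `K(R; I^s)_0` given by the empty monomial in `U^(0)`. -/
def unitElement {s : ℕ} (hs : 0 < s) : Res R ι s 0 :=
  component s hs (Finsupp.single Sym.nil 1)

/-- Modulo boundaries, a monomial `m` of degree `k` is `(-θ)^k m(u)` times the empty monomial. -/
theorem component_single_sub_mem {s k : ℕ} (hs : 0 < s) (h : k < s) (m : Sym ι k) :
    component s h (Finsupp.single m 1) -
      ((-((θ : ℤ) : R)) ^ k * ((m : Multiset ι).map u).prod) • unitElement hs ∈
        LinearMap.range (twistedD u θ s 0) := by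
  induction k with
  | zero =>
    obtain rfl : m = Sym.nil := Subsingleton.elim _ _
    simp [unitElement]
  | succ k ih =>
    obtain ⟨i, m, rfl⟩ := m.exists_eq_cons_of_succ
    have h' : k < s := Nat.lt_of_succ_lt h
    have hd := twistedD_incl_wedge u θ h' (fun _ => Finsupp.single i 1) (Finsupp.single m 1)
    rw [dif_pos h, Finsupp.linearCombination_single, one_smul, varMul_single_single, one_mul] at hd
    have key := sub_mem (Submodule.smul_mem _ ((θ : ℤ) : R) (LinearMap.mem_range.2 ⟨_, hd⟩))
      (Submodule.smul_mem _ (((θ : ℤ) : R) * u i) (ih h' m))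
    convert key using 1
    rw [prod_map_cons]
    simp only [smul_add, smul_sub, smul_smul, sign_mul_self, one_smul]
    rw [show (-((θ : ℤ) : R)) ^ (k + 1) * (u i * ((m : Multiset ι).map u).prod) =
      -(((θ : ℤ) : R) * u i * ((-((θ : ℤ) : R)) ^ k * ((m : Multiset ι).map u).prod)) by ring,
      neg_smul]
    abel

/-- `I^s` annihilates the class of the empty monomial modulo boundaries, because
`d (e_i ⊗ m) = u_i m` for `m` of the top degree `s - 1`. -/
theorem smul_unitElement_mem {s : ℕ} (hs : 0 < s) {r : R}
    (hr : r ∈ Ideal.span (Set.range u) ^ s) :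
    r • unitElement hs ∈ LinearMap.range (twistedD u θ s 0) := by
  suffices Ideal.span (Set.range u) ^ s ≤ (LinearMap.range (twistedD u θ s 0)).comap
      (LinearMap.toSpanSingleton R (Res R ι s 0) (unitElement hs)) from this hr
  rw [span_pow_eq_span_monomials, Ideal.span_le]
  rintro _ ⟨m, rfl⟩
  obtain ⟨s, rfl⟩ := Nat.exists_eq_add_one.2 hs
  obtain ⟨i, m, rfl⟩ := m.exists_eq_cons_of_succ
  have h' := Nat.lt_succ_self s
  have hd := twistedD_incl_wedge u θ h' (fun _ => Finsupp.single i 1) (Finsupp.single m 1)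
  rw [dif_neg (lt_irrefl _), Finsupp.linearCombination_single, one_smul, add_zero] at hd
  have key := Submodule.smul_mem _ ((-((θ : ℤ) : R)) ^ s)
    (sub_mem (LinearMap.mem_range.2 ⟨_, hd⟩)
      (Submodule.smul_mem _ (u i) (component_single_sub_mem u θ hs h' m)))
  rw [SetLike.mem_coe, Submodule.mem_comap, LinearMap.toSpanSingleton_apply]
  convert key using 1
  rw [smul_sub (u i), sub_sub_cancel, smul_smul, smul_smul]
  congr 1
  have hθ : (-((θ : ℤ) : R)) ^ s * (-((θ : ℤ) : R)) ^ s = 1 := by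
    rw [← mul_pow, neg_mul_neg, sign_mul_self, one_pow]
  beta_reduce
  rw [prod_map_cons]
  linear_combination (-(u i * ((m : Multiset ι).map u).prod)) * hθ

/-- Every element of degree zero is congruent, modulo boundaries, to its signed evaluation times the
empty monomial. -/
theorem sub_signedEval_smul_mem {s : ℕ} (hs : 0 < s) (x : Res R ι s 0) :
    x - signedEval u θ s x • unitElement hs ∈ LinearMap.range (twistedD u θ s 0) := by
  rw [← Submodule.Quotient.eq]
  suffices (LinearMap.range (twistedD u θ s 0)).mkQ = (LinearMap.range (twistedD u θ s 0)).mkQ ∘ₗ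
      LinearMap.toSpanSingleton R (Res R ι s 0) (unitElement hs) ∘ₗ signedEval u θ s from
    LinearMap.congr_fun this x
  refine Res.hom_ext fun k hk v f => ?_
  obtain rfl : v = 0 := Subsingleton.elim _ _
  change ((LinearMap.range (twistedD u θ s 0)).mkQ ∘ₗ component s hk) f =
    (((LinearMap.range (twistedD u θ s 0)).mkQ ∘ₗ
      LinearMap.toSpanSingleton R (Res R ι s 0) (unitElement hs) ∘ₗ signedEval u θ s) ∘ₗ
        component s hk) f
  congr 1
  refine Finsupp.lhom_ext' fun m => LinearMap.ext_ring ?_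
  refine (Submodule.Quotient.eq _).2 ?_
  change component s hk (Finsupp.single m (1 : R)) -
    signedEval u θ s (component s hk (Finsupp.single m (1 : R))) • unitElement hs ∈
      LinearMap.range (twistedD u θ s 0)
  rw [signedEval_component, evalPoly_single, one_mul]
  exact component_single_sub_mem u θ hs hk m

theorem signedEval_unitElement {s : ℕ} (hs : 0 < s) :
    signedEval u θ s (unitElement hs) = 1 := by
  rw [unitElement, signedEval_component, evalPoly_single]
  simp

theorem twistedD_augmentation_exact {s : ℕ} (hs : 0 < s) :
    Function.Exact (twistedD u θ s 0) (augmentation u θ s) := by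
  intro x
  rw [augmentation_apply, Ideal.Quotient.eq_zero_iff_mem]
  constructor
  · intro hx
    have := add_mem (sub_signedEval_smul_mem u θ hs x) (smul_unitElement_mem u θ hs hx)
    rwa [sub_add_cancel] at this
  · rintro ⟨y, rfl⟩
    exact signedEval_twistedD_mem u θ y

theorem augmentation_surjective {s : ℕ} (hs : 0 < s) :
    Function.Surjective (augmentation u θ s) := by
  intro q
  obtain ⟨r, rfl⟩ := Ideal.Quotient.mk_surjective q
  exact ⟨r • unitElement hs, by
    rw [augmentation_apply, map_smul, signedEval_unitElement, smul_eq_mul, mul_one]⟩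

end

end PowerKoszul

theorem mainTheorem1 {R : Type*} [CommRing R] {N : ℕ∞} (u : SeqIndex N → R)
    (hu : IsRegularSequence u) (s : ℕ) (hs : 1 ≤ s) (θ : ℤˣ) :
    (∀ n : ℕ, Module.Free R (PowerKoszul.Res R (SeqIndex N) s n)) ∧
    (∀ n : ℕ, Function.Exact (PowerKoszul.twistedD u θ s (n + 1)) (PowerKoszul.twistedD u θ s n)) ∧
    Function.Exact (PowerKoszul.twistedD u θ s 0) (PowerKoszul.augmentation u θ s) ∧
    Function.Surjective (PowerKoszul.augmentation u θ s) :=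
  ⟨fun _ => inferInstance,
    fun n => PowerKoszul.twistedD_exact_of_koszulD_exact u θ (PowerKoszul.koszulD_exact hu n) s,
    PowerKoszul.twistedD_augmentation_exact u θ hs, PowerKoszul.augmentation_surjective u θ hs⟩
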